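/- Let $R$ be an associative ring with $1$ and let $n\ge 0$ be an integer. Modules are right $R$-modules, and $T^{(\alpha)}$ denotes the direct sum of $\alpha$ copies of $T$. A module $T$ is called $n$-tilting if (T1) there is an exact sequence $0\to P_n\to\dots\to P_1\to P_0\to T\to 0$ with all $P_i$ projective; (T2) $\operatorname{Ext}^i_R(T,T^{(\alpha)})=0$ for each $i>0$ and each cardinal $\alpha$; (T3) for some $m\ge 0$ there is an exact sequence $0\to R\to T_0\to T_1\to\dots\to T_m\to 0$ in which every $T_i$ is a direct summand of an arbitrary direct sum of copies of $T$. An $n$-tilting module $T$ is called good if moreover (T3') there is an exact sequence $0\to R\to T_0\to T_1\to\dots\to T_n\to 0$ in which every $T_i$ is a direct summand of a finite direct sum of copies of $T$. Let $\operatorname{Gen}_n(T)$ be the class of all modules $M$ for which there is an exact sequence $T^{(\alpha_n)}\to\dots\to T^{(\alpha_1)}\to M\to 0$ for some cardinals $\alpha_1,\dots,\alpha_n$ (for $n=0$ this is the class of all modules). Two $n$-tilting modules $T,T'$ are called equivalent if $\operatorname{Gen}_n(T)=\operatorname{Gen}_n(T')$. For $i\ge 0$ let $KE_i(T)$ be the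 class of all modules $M$ with $\operatorname{Ext}^j_R(T,M)=0$ for all $j\ge 0$ with $j\ne i$. Proposition. For every $n$-tilting module $T$ there exists a good $n$-tilting module $T'$ equivalent to $T$ such that $KE_i(T)=KE_i(T')$ for every $i\ge 0$. -/

import Mathlib

open CategoryTheory

universe u

/-! Right `R`-modules are modules over `Rᵐᵒᵖ`. The direct sum `T^(α)` is `α →₀ T`. -/

namespace RightTilting

variable {R : Type u} [Ring R]

/-- `X` is (isomorphic to) a direct summand of `Y`. -/
def IsDirectSummand {S : Type*} [Ring S] (X Y : Type*) [AddCommGroup X] [AddCommGroup Y]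
    [Module S X] [Module S Y] : Prop :=
  ∃ (i : X →ₗ[S] Y) (p : Y →ₗ[S] X), p ∘ₗ i = LinearMap.id

/-- `X` is a direct summand of an arbitrary direct sum of copies of `T`. -/
def IsSummandOfCopies (T X : ModuleCat.{u} Rᵐᵒᵖ) : Prop :=
  ∃ α : Type u, IsDirectSummand (S := Rᵐᵒᵖ) X (α →₀ T)

/-- `X` is a direct summand of a finite direct sum of copies of `T`. -/
def IsSummandOfFiniteCopies (T X : ModuleCat.{u} Rᵐᵒᵖ) : Prop :=
  ∃ k : ℕ, IsDirectSummand (S := Rᵐᵒᵖ) X (Fin k →₀ T)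

/-- There is an exact sequence `0 → P n → ⋯ → P 1 → P 0 → T → 0` with all `P i` projective
(continued by zero modules beyond `P n`). -/
def HasProjectiveResolutionOfLength (n : ℕ) (T : ModuleCat.{u} Rᵐᵒᵖ) : Prop :=
  ∃ (P : ℕ → ModuleCat.{u} Rᵐᵒᵖ) (d : ∀ i, P (i + 1) →ₗ[Rᵐᵒᵖ] P i) (ε : P 0 →ₗ[Rᵐᵒᵖ] T),
    (∀ i, Module.Projective Rᵐᵒᵖ (P i)) ∧
    (∀ i, n < i → Subsingleton (P i)) ∧
    Function.Surjective ε ∧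
    Function.Exact (d 0) ε ∧
    ∀ i, Function.Exact (d (i + 1)) (d i)

/-- There is an exact sequence `0 → A → X 0 → X 1 → ⋯ → X m → 0` with `X 0, …, X m`
in the class `C` (continued by zero modules beyond `X m`). -/
def HasCoresolutionOfLength (C : ModuleCat.{u} Rᵐᵒᵖ → Prop) (m : ℕ)
    (A : ModuleCat.{u} Rᵐᵒᵖ) : Prop :=
  ∃ (X : ℕ → ModuleCat.{u} Rᵐᵒᵖ) (d : ∀ i, X i →ₗ[Rᵐᵒᵖ] X (i + 1)) (η : A →ₗ[Rᵐᵒᵖ] X 0),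
    (∀ i, i ≤ m → C (X i)) ∧
    (∀ i, m < i → Subsingleton (X i)) ∧
    Function.Injective η ∧
    Function.Exact η (d 0) ∧
    ∀ i, Function.Exact (d i) (d (i + 1))

/-- `T` is an `n`-tilting right `R`-module. -/
structure IsTilting (n : ℕ) (T : ModuleCat.{u} Rᵐᵒᵖ) : Prop where
  projectiveResolution : HasProjectiveResolutionOfLength n T
  ext_copies : ∀ i : ℕ, 0 < i → ∀ α : Type u,
    Subsingleton (Abelian.Ext T (ModuleCat.of Rᵐᵒᵖ (α →₀ T)) i)
  coresolution : ∃ m : ℕ,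
    HasCoresolutionOfLength (IsSummandOfCopies T) m (ModuleCat.of Rᵐᵒᵖ R)

/-- `T` is a good `n`-tilting right `R`-module. -/
structure IsGoodTilting (n : ℕ) (T : ModuleCat.{u} Rᵐᵒᵖ) : Prop extends IsTilting n T where
  finiteCoresolution :
    HasCoresolutionOfLength (IsSummandOfFiniteCopies T) n (ModuleCat.of Rᵐᵒᵖ R)

/-- The class `Gen_n(T)` of all `M` for which there is an exact sequence
`T^(α_n) → ⋯ → T^(α_1) → M → 0`. Here `α i` stands for `α_(i+1)`, and only `α 0, …, α (n-1)`
and the maps between them matter; for `n = 0` no condition is left. -/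
def Gen (n : ℕ) (T : ModuleCat.{u} Rᵐᵒᵖ) : Set (ModuleCat.{u} Rᵐᵒᵖ) :=
  {M | ∃ (α : ℕ → Type u) (d : ∀ i, (α (i + 1) →₀ T) →ₗ[Rᵐᵒᵖ] (α i →₀ T))
      (ε : (α 0 →₀ T) →ₗ[Rᵐᵒᵖ] M),
    (1 ≤ n → Function.Surjective ε) ∧
    (2 ≤ n → Function.Exact (d 0) ε) ∧
    ∀ i, i + 3 ≤ n → Function.Exact (d (i + 1)) (d i)}

/-- Equivalence of `n`-tilting modules: `Gen_n(T) = Gen_n(T')`. -/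
def TiltingEquivalent (n : ℕ) (T T' : ModuleCat.{u} Rᵐᵒᵖ) : Prop :=
  Gen n T = Gen n T'

/-- The class `KE_i(T)` of all `M` with `Ext^j_R(T, M) = 0` for all `j ≥ 0`, `j ≠ i`. -/
def KE (i : ℕ) (T : ModuleCat.{u} Rᵐᵒᵖ) : Set (ModuleCat.{u} Rᵐᵒᵖ) :=
  {M | ∀ j : ℕ, j ≠ i → Subsingleton (Abelian.Ext T M j)}

end RightTilting

/-!
The module `T'` is a copower `T^(A)` of `T`, for a suitable nonempty index set `A`.

A coresolution of `R` of some length `m` by direct summands of direct sums of copies of `T` can be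
shortened to length `n`. Indeed, if `m > n`, dimension shifting identifies the obstruction to
splitting its last map with an element of `Ext^m(X, R)`, where `X` is a summand of copies of `T`,
and this group vanishes since the projective dimension of `T` is at most `n`. So the last map
splits, and its kernel is again a summand of copies of `T`
(`HasCoresolutionOfLength.shorten`, `IsTilting.hasCoresolutionOfLength`). The terms of the
resulting coresolution are summands of `T^(B 0), …, T^(B n)`; as soon as `A` contains the disjoint
union of the `B i`, each of them is a summand of one copy of `T^(A)`
(`IsTilting.exists_coresolution_finsupp`).

It remains to see that passing from `T` to `T^(A)` changes nothing else. The vanishing of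
`Ext^j(T, M)` and of `Ext^j(T^(A), M)` are equivalent (`subsingleton_ext_finsupp` and the fact
that `T` is a retract of `T^(A)`), so the classes `KE_i` agree. A sequence of copowers of `T^(A)` is
a sequence of copowers of `T`; conversely, adding to a sequence of copowers of `T` a contractible
complex with terms `T^(δ)`, for a large infinite set `δ`, turns all its terms into copowers
of `T^(A)` (`Gen_subset_Gen_finsupp`), so the classes `Gen_n` agree.
-/

namespace RightTilting

/-! ### Vanishing of Ext and dimension shifting -/

section Ext

open Abelian

variable {S : Type u} [Ring S]

theorem shortExact_of_exact {A B C : ModuleCat.{u} S} (f : A →ₗ[S] B) (g : B →ₗ[S] C)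
    (hf : Function.Injective f) (hfg : Function.Exact f g) (hg : Function.Surjective g) :
    (ShortComplex.mk (ModuleCat.ofHom f) (ModuleCat.ofHom g)
      (by ext x; exact hfg.apply_apply_eq_zero x)).ShortExact where
  exact := (ShortComplex.ShortExact.moduleCat_exact_iff_function_exact _).2 hfg
  mono_f := (ModuleCat.mono_iff_injective _).2 hf
  epi_g := (ModuleCat.epi_iff_surjective _).2 hg

theorem subsingleton_ext_left_term {E : ShortComplex (ModuleCat.{u} S)} (hE : E.ShortExact)
    (X : ModuleCat.{u} S) (n : ℕ) (h₃ : Subsingleton (Ext X E.X₃ n))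
    (h₂ : Subsingleton (Ext X E.X₂ (n + 1))) : Subsingleton (Ext X E.X₁ (n + 1)) := by
  refine subsingleton_of_forall_eq 0 fun x ↦ ?_
  obtain ⟨y, rfl⟩ := Ext.covariant_sequence_exact₁ X hE x (Subsingleton.elim _ _) rfl
  rw [Subsingleton.elim y 0, Ext.zero_comp]

theorem subsingleton_ext_right_term {E : ShortComplex (ModuleCat.{u} S)} (hE : E.ShortExact)
    (X : ModuleCat.{u} S) (n : ℕ) (h₂ : Subsingleton (Ext X E.X₂ n))
    (h₁ : Subsingleton (Ext X E.X₁ (n + 1))) : Subsingleton (Ext X E.X₃ n) := by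
  refine subsingleton_of_forall_eq 0 fun x ↦ ?_
  obtain ⟨y, rfl⟩ := Ext.covariant_sequence_exact₃ X hE x rfl (Subsingleton.elim _ _)
  rw [Subsingleton.elim y 0, Ext.zero_comp]

theorem exists_lift_of_subsingleton_ext_one {E : ShortComplex (ModuleCat.{u} S)}
    (hE : E.ShortExact) (X : ModuleCat.{u} S) (h : Subsingleton (Ext X E.X₁ 1)) (φ : X ⟶ E.X₃) :
    ∃ ψ : X ⟶ E.X₂, ψ ≫ E.g = φ := by
  obtain ⟨y, hy⟩ := Ext.covariant_sequence_exact₃ X hE (Ext.mk₀ φ) (zero_add 1)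
    (Subsingleton.elim _ _)
  obtain ⟨ψ, rfl⟩ := (Ext.mk₀_bijective X E.X₂).2 y
  refine ⟨ψ, (Ext.mk₀_bijective X E.X₃).1 ?_⟩
  rw [← hy, Ext.mk₀_comp_mk₀]

theorem subsingleton_ext_of_retract {X Y Z W : ModuleCat.{u} S} (h : Retract X Y)
    (h' : Retract Z W) (n : ℕ) (hn : Subsingleton (Ext Y W n)) : Subsingleton (Ext X Z n) := by
  refine subsingleton_of_forall_eq 0 fun x ↦ ?_
  calc x = (Ext.mk₀ (h.i ≫ h.r)).comp (x.comp (Ext.mk₀ (h'.i ≫ h'.r)) (add_zero n))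
        (zero_add n) := by simp
    _ = (Ext.mk₀ h.i).comp ((((Ext.mk₀ h.r).comp x (zero_add n)).comp
          (Ext.mk₀ h'.i) (add_zero n)).comp (Ext.mk₀ h'.r) (add_zero n)) (zero_add n) := by
        rw [← Ext.mk₀_comp_mk₀, ← Ext.mk₀_comp_mk₀]
        simp only [Ext.comp_assoc_of_third_deg_zero, Ext.mk₀_comp_mk₀_assoc,
          Ext.mk₀_comp_mk₀]
    _ = 0 := by
        rw [Subsingleton.elim (((Ext.mk₀ h.r).comp x (zero_add n)).comp _ _) 0, Ext.zero_comp,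
          Ext.comp_zero]

/-- Vanishing of `Ext^n(-, Y)` passes from `T` to its copowers. The proof shifts the degree along
an embedding of `Y` into an injective module, which reduces it to degrees `0` and `1`, where it is
the universal property of the direct sum. -/
theorem subsingleton_ext_finsupp (T : ModuleCat.{u} S) (A : Type u) (n : ℕ) :
    ∀ Y : ModuleCat.{u} S, Subsingleton (Ext T Y n) →
      Subsingleton (Ext (ModuleCat.of S (A →₀ T)) Y n) := by
  induction n with
  | zero =>
    intro Y h
    have : Subsingleton (T ⟶ Y) := Ext.homEquiv₀.symm.subsingleton
    have : Subsingleton (ModuleCat.of S (A →₀ T) ⟶ Y) := ⟨fun f g ↦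
      ModuleCat.hom_ext (Finsupp.lhom_ext' fun a ↦ congrArg ModuleCat.Hom.hom (Subsingleton.elim
        (ModuleCat.ofHom (f.hom ∘ₗ Finsupp.lsingle a))
        (ModuleCat.ofHom (g.hom ∘ₗ Finsupp.lsingle a))))⟩
    exact Ext.homEquiv₀.subsingleton
  | succ n ih =>
    intro Y h
    let E := ShortComplex.mk (Injective.ι Y) (Limits.cokernel.π (Injective.ι Y))
      (Limits.cokernel.condition _)
    have hE : E.ShortExact :=
      { exact := ShortComplex.exact_cokernel _
        mono_f := inferInstanceAs (Mono (Injective.ι Y))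
        epi_g := inferInstanceAs (Epi (Limits.cokernel.π _)) }
    have hI (X : ModuleCat.{u} S) (k : ℕ) : Subsingleton (Ext X E.X₂ (k + 1)) :=
      Ext.subsingleton_of_injective X (Injective.under Y) k
    cases n with
    | succ n =>
      exact subsingleton_ext_left_term hE _ _
        (ih _ (subsingleton_ext_right_term hE _ _ (hI _ _) h)) (hI _ _)
    | zero =>
      refine subsingleton_of_forall_eq 0 fun x ↦ ?_
      have := hI (ModuleCat.of S (A →₀ T)) 0
      obtain ⟨y, rfl⟩ := Ext.covariant_sequence_exact₁ _ hE x (Subsingleton.elim _ _) (zero_add 1)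
      obtain ⟨φ, rfl⟩ := (Ext.mk₀_bijective _ _).2 y
      choose ψ hψ using fun a : A ↦ exists_lift_of_subsingleton_ext_one hE T h
        (ModuleCat.ofHom (φ.hom ∘ₗ Finsupp.lsingle a))
      have hφ : ModuleCat.ofHom (Finsupp.lsum ℕ fun a ↦ (ψ a).hom) ≫ E.g = φ := by
        refine ModuleCat.hom_ext (Finsupp.lhom_ext' fun a ↦ LinearMap.ext fun t ↦ ?_)
        simpa using congrArg (fun f ↦ f.hom t) (hψ a)
      rw [← hφ, ← Ext.mk₀_comp_mk₀, Ext.comp_assoc _ _ _ _ (zero_add 1) (by simp),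
        hE.comp_extClass, Ext.comp_zero]

end Ext

variable {R : Type u} [Ring R]

/-! ### Direct summands of direct sums of copies -/

section Summand

variable {S : Type*} [Ring S] {X Y Z : Type*} [AddCommGroup X] [AddCommGroup Y] [AddCommGroup Z]
  [Module S X] [Module S Y] [Module S Z]

theorem IsDirectSummand.trans (h : IsDirectSummand (S := S) X Y)
    (h' : IsDirectSummand (S := S) Y Z) : IsDirectSummand (S := S) X Z := by
  obtain ⟨i, p, h⟩ := h
  obtain ⟨i', p', h'⟩ := h'
  refine ⟨i' ∘ₗ i, p ∘ₗ p', LinearMap.ext fun x ↦ ?_⟩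
  exact (congrArg p (LinearMap.congr_fun h' (i x))).trans (LinearMap.congr_fun h x)

theorem isDirectSummand_of_linearEquiv (e : X ≃ₗ[S] Y) : IsDirectSummand (S := S) X Y :=
  ⟨e, e.symm, by ext; simp⟩

theorem isDirectSummand_of_subsingleton [Subsingleton X] : IsDirectSummand (S := S) X Y :=
  ⟨0, 0, LinearMap.ext fun _ ↦ Subsingleton.elim _ _⟩

theorem isDirectSummand_finsupp_of_injective {A B : Type*} (f : A → B)
    (hf : Function.Injective f) : IsDirectSummand (S := S) (A →₀ X) (B →₀ X) :=
  ⟨Finsupp.lmapDomain X S f, Finsupp.lcomapDomain f hf,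
    LinearMap.ext (Finsupp.leftInverse_lcomapDomain_mapDomain (R := S) f hf)⟩

theorem isDirectSummand_finsupp_self {A : Type*} (a : A) :
    IsDirectSummand (S := S) X (A →₀ X) :=
  ⟨Finsupp.lsingle a, Finsupp.lapply a, by ext; simp⟩

/-- In a short exact sequence `X → Y → Z` whose right map has a section, the left term is a direct
summand of the middle one. -/
theorem isDirectSummand_of_section {f : X →ₗ[S] Y} {g : Y →ₗ[S] Z} (hf : Function.Injective f)
    (hfg : Function.Exact f g) (s : Z →ₗ[S] Y) (hs : g ∘ₗ s = LinearMap.id) :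
    IsDirectSummand (S := S) X Y := by
  have h (y : Y) : (LinearMap.id - s ∘ₗ g : Y →ₗ[S] Y) y ∈ LinearMap.range f :=
    (hfg _).1 (by simpa [sub_eq_zero] using (LinearMap.congr_fun hs (g y)).symm)
  refine ⟨f, (LinearEquiv.ofInjective f hf).symm ∘ₗ LinearMap.codRestrict _ _ h,
    LinearMap.ext fun x ↦ ?_⟩
  rw [LinearMap.comp_apply, LinearMap.comp_apply, LinearEquiv.coe_coe, LinearEquiv.symm_apply_eq]
  ext
  simp [hfg.apply_apply_eq_zero]

end Summand

theorem IsDirectSummand.nonempty_retract {S : Type u} [Ring S] {X Y : ModuleCat.{u} S}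
    (h : IsDirectSummand (S := S) X Y) : Nonempty (Retract X Y) := by
  obtain ⟨i, p, h⟩ := h
  exact ⟨⟨ModuleCat.ofHom i, ModuleCat.ofHom p, ModuleCat.hom_ext h⟩⟩

theorem IsSummandOfCopies.of_isDirectSummand {T X Y : ModuleCat.{u} Rᵐᵒᵖ}
    (h : IsDirectSummand (S := Rᵐᵒᵖ) X Y) (hY : IsSummandOfCopies T Y) :
    IsSummandOfCopies T X :=
  let ⟨A, hA⟩ := hY
  ⟨A, h.trans hA⟩

theorem IsSummandOfFiniteCopies.isSummandOfCopies {T X : ModuleCat.{u} Rᵐᵒᵖ}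
    (h : IsSummandOfFiniteCopies T X) : IsSummandOfCopies T X :=
  let ⟨k, hk⟩ := h
  ⟨ULift (Fin k), hk.trans (isDirectSummand_finsupp_of_injective ULift.up ULift.up_injective)⟩

/-! ### Exactness and direct sums of copies -/

theorem exact_finsupp_mapRange {S : Type*} [Ring S] {X Y Z : Type*} [AddCommGroup X]
    [AddCommGroup Y] [AddCommGroup Z] [Module S X] [Module S Y] [Module S Z] (A : Type*)
    {f : X →ₗ[S] Y} {g : Y →ₗ[S] Z} (h : Function.Exact f g) :
    Function.Exact (Finsupp.mapRange.linearMap (α := A) f)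
      (Finsupp.mapRange.linearMap (α := A) g) := by
  classical
  intro v
  constructor
  · intro hv
    have key (a : A) : ∃ x, f x = v a := (h _).1 (by simpa using DFunLike.congr_fun hv a)
    choose x hx using key
    refine ⟨Finsupp.onFinset v.support (fun a ↦ if v a = 0 then 0 else x a) (by simp_all),
      Finsupp.ext fun a ↦ ?_⟩
    by_cases ha : v a = 0 <;> simp [ha, hx]
  · rintro ⟨w, rfl⟩
    ext a
    simp [h.apply_apply_eq_zero]

theorem HasProjectiveResolutionOfLength.finsupp {n : ℕ} {T : ModuleCat.{u} Rᵐᵒᵖ}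
    (h : HasProjectiveResolutionOfLength n T) (A : Type u) :
    HasProjectiveResolutionOfLength n (ModuleCat.of Rᵐᵒᵖ (A →₀ T)) := by
  obtain ⟨P, d, ε, hP, hn, hε, h₀, hd⟩ := h
  refine ⟨fun i ↦ ModuleCat.of Rᵐᵒᵖ (A →₀ P i), fun i ↦ Finsupp.mapRange.linearMap (d i),
    Finsupp.mapRange.linearMap ε, fun i ↦ ?_, fun i hi ↦ ?_,
    Finsupp.mapRange_surjective _ (map_zero ε) hε, exact_finsupp_mapRange A h₀,
    fun i ↦ exact_finsupp_mapRange A (hd i)⟩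
  · have := hP i
    classical
    exact Module.Projective.of_equiv (finsuppLequivDFinsupp Rᵐᵒᵖ).symm
  · have := hn i hi
    exact inferInstanceAs (Subsingleton (A →₀ P i))

theorem HasProjectiveResolutionOfLength.hasProjectiveDimensionLE (n : ℕ) :
    ∀ T : ModuleCat.{u} Rᵐᵒᵖ, HasProjectiveResolutionOfLength n T →
      HasProjectiveDimensionLE T n := by
  induction n with
  | zero =>
    rintro T ⟨P, d, ε, hP, hn, hε, h₀, -⟩
    have := hn 1 one_pos
    have hinj : Function.Injective ε := (injective_iff_map_eq_zero ε).2 fun x hx ↦ by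
      obtain ⟨y, rfl⟩ := (h₀ x).1 hx
      rw [Subsingleton.elim y 0, map_zero]
    have := hP 0
    have := Module.Projective.of_equiv (LinearEquiv.ofBijective ε ⟨hinj, hε⟩)
    have : Projective T := (IsProjective.iff_projective (R := Rᵐᵒᵖ) (P := T)).1 this
    exact inferInstanceAs (HasProjectiveDimensionLT T 1)
  | succ n ih =>
    rintro T ⟨P, d, ε, hP, hn, hε, h₀, hd⟩
    have hker (x : P 1) : d 0 x ∈ LinearMap.ker ε := h₀.apply_apply_eq_zero x
    have hK : HasProjectiveDimensionLE (ModuleCat.of Rᵐᵒᵖ (LinearMap.ker ε)) n := by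
      refine ih _ ⟨fun i ↦ P (i + 1), fun i ↦ d (i + 1), (d 0).codRestrict _ hker,
        fun i ↦ hP _, fun i hi ↦ hn _ (by lia), ?_, fun x ↦ ?_, fun i ↦ hd (i + 1)⟩
      · rintro ⟨x, hx⟩
        obtain ⟨y, rfl⟩ := (h₀ x).1 hx
        exact ⟨y, rfl⟩
      · rw [← hd 0 x]
        simp [Subtype.ext_iff]
    have hP₀ : Projective (P 0) := (IsProjective.iff_projective (R := Rᵐᵒᵖ) (P := P 0)).1 (hP 0)
    exact ((shortExact_of_exact (A := ModuleCat.of Rᵐᵒᵖ (LinearMap.ker ε))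
      (LinearMap.ker ε).subtype ε Subtype.val_injective
      (LinearMap.exact_subtype_ker_map ε) hε).hasProjectiveDimensionLT_X₃_iff n hP₀).2 hK

/-! ### Shortening coresolutions -/

section Coresolution

variable {C : ModuleCat.{u} Rᵐᵒᵖ → Prop}

theorem HasCoresolutionOfLength.of_mem {A : ModuleCat.{u} Rᵐᵒᵖ} (hA : C A) :
    HasCoresolutionOfLength C 0 A := by
  let X : ℕ → ModuleCat.{u} Rᵐᵒᵖ := fun
    | 0 => A
    | _ + 1 => ModuleCat.of Rᵐᵒᵖ PUnit
  have hX (i : ℕ) : Subsingleton (X (i + 1)) := inferInstanceAs (Subsingleton PUnit)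
  refine ⟨X, fun _ ↦ 0, LinearMap.id, fun i hi ↦ ?_, fun i hi ↦ ?_, Function.injective_id,
    fun x ↦ ?_, fun i x ↦ ?_⟩
  · obtain rfl : i = 0 := by lia
    exact hA
  · obtain ⟨i, rfl⟩ := Nat.exists_eq_succ_of_ne_zero hi.ne'
    exact hX i
  · simp
  · have := hX i
    exact iff_of_true (Subsingleton.elim _ _) ⟨0, Subsingleton.elim _ _⟩

theorem HasCoresolutionOfLength.nonempty_linearEquiv {A : ModuleCat.{u} Rᵐᵒᵖ}
    (h : HasCoresolutionOfLength C 0 A) :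
    ∃ X : ModuleCat.{u} Rᵐᵒᵖ, C X ∧ Nonempty (A ≃ₗ[Rᵐᵒᵖ] X) := by
  obtain ⟨X, d, η, hX, h0, hη, h₀, -⟩ := h
  have := h0 1 one_pos
  exact ⟨X 0, hX 0 le_rfl, ⟨LinearEquiv.ofBijective η
    ⟨hη, fun x ↦ (h₀ x).1 (Subsingleton.elim _ _)⟩⟩⟩

/-- A coresolution of length `m + 1` is a short exact sequence starting with a module of the class,
followed by a coresolution of length `m` of its cokernel. This makes induction on the length
possible. -/
theorem hasCoresolutionOfLength_succ_iff {m : ℕ} {A : ModuleCat.{u} Rᵐᵒᵖ} :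
    HasCoresolutionOfLength C (m + 1) A ↔
      ∃ (X B : ModuleCat.{u} Rᵐᵒᵖ) (f : A →ₗ[Rᵐᵒᵖ] X) (g : X →ₗ[Rᵐᵒᵖ] B), C X ∧
        Function.Injective f ∧ Function.Exact f g ∧ Function.Surjective g ∧
        HasCoresolutionOfLength C m B := by
  constructor
  · rintro ⟨X, d, η, hX, h0, hη, h₀, hd⟩
    refine ⟨X 0, ModuleCat.of Rᵐᵒᵖ (LinearMap.range (d 0)), η, (d 0).rangeRestrict,
      hX 0 (by lia), hη, fun x ↦ ?_, (d 0).surjective_rangeRestrict,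
      fun i ↦ X (i + 1), fun i ↦ d (i + 1), (LinearMap.range (d 0)).subtype,
      fun i hi ↦ hX _ (by lia), fun i hi ↦ h0 _ (by lia), Subtype.val_injective, fun x ↦ ?_,
      fun i ↦ hd (i + 1)⟩
    · rw [← h₀ x]
      simp [Subtype.ext_iff]
    · rw [hd 0 x]
      simp
  · rintro ⟨X₀, B, f, g, hX₀, hf, hfg, hg, X, d, η, hX, h0, hη, h₀, hd⟩
    let X' : ℕ → ModuleCat.{u} Rᵐᵒᵖ := fun
      | 0 => X₀
      | i + 1 => X i
    let d' : ∀ i, X' i →ₗ[Rᵐᵒᵖ] X' (i + 1) := fun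
      | 0 => η ∘ₗ g
      | i + 1 => d i
    refine ⟨X', d', f, fun i hi ↦ ?_, fun i hi ↦ ?_, hf, fun x ↦ ?_, fun i ↦ ?_⟩
    · cases i with
      | zero => exact hX₀
      | succ i => exact hX i (by lia)
    · cases i with
      | zero => lia
      | succ i => exact h0 i (by lia)
    · rw [← hfg x]
      exact map_eq_zero_iff η hη
    · cases i with
      | zero =>
        intro x
        refine (h₀ x).trans ⟨?_, ?_⟩
        · rintro ⟨b, rfl⟩
          obtain ⟨y, rfl⟩ := hg b
          exact ⟨y, rfl⟩
        · rintro ⟨y, rfl⟩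
          exact ⟨g y, rfl⟩
      | succ i => exact hd i

theorem HasCoresolutionOfLength.of_le (h0 : ∀ X : ModuleCat.{u} Rᵐᵒᵖ, Subsingleton X → C X)
    {m n : ℕ} (hmn : m ≤ n) {A : ModuleCat.{u} Rᵐᵒᵖ} (h : HasCoresolutionOfLength C m A) :
    HasCoresolutionOfLength C n A := by
  obtain ⟨X, d, η, hX, hz, hη, h₀, hd⟩ := h
  refine ⟨X, d, η, fun i _ ↦ ?_, fun i hi ↦ hz i (hmn.trans_lt hi), hη, h₀, hd⟩
  rcases le_or_gt i m with hi | hi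
  exacts [hX i hi, h0 _ (hz i hi)]

/-- If `Ext^(m+1)(X, A) = 0` for all `X` in `C`, the last map of a `C`-coresolution of `A` of
length `m + 1` splits: by dimension shifting, its kernel `K` and the last term `X` satisfy
`Ext^1(X, K) = Ext^(m+1)(X, A) = 0`. The kernel then belongs to `C` and can serve as the last term
of a shorter coresolution. -/
theorem HasCoresolutionOfLength.shorten
    (hC : ∀ X Y : ModuleCat.{u} Rᵐᵒᵖ, IsDirectSummand (S := Rᵐᵒᵖ) X Y → C Y → C X)
    (hext : ∀ X Y : ModuleCat.{u} Rᵐᵒᵖ, C X → C Y → ∀ i,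
      Subsingleton (Abelian.Ext X Y (i + 1)))
    (m : ℕ) : ∀ A : ModuleCat.{u} Rᵐᵒᵖ,
      (∀ X, C X → Subsingleton (Abelian.Ext X A (m + 1))) →
      HasCoresolutionOfLength C (m + 1) A → HasCoresolutionOfLength C m A := by
  induction m with
  | zero =>
    intro A hA h
    obtain ⟨X, B, f, g, hX, hf, hfg, hg, hB⟩ := hasCoresolutionOfLength_succ_iff.1 h
    obtain ⟨Y, hY, ⟨e⟩⟩ := hB.nonempty_linearEquiv
    have hB : C B := hC B Y (isDirectSummand_of_linearEquiv e) hY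
    obtain ⟨s, hs⟩ := exists_lift_of_subsingleton_ext_one (shortExact_of_exact f g hf hfg hg) B
      (hA B hB) (𝟙 B)
    -- The section `s` of `g : X → B` makes `A` a direct summand of `X`.
    exact .of_mem (hC A X (isDirectSummand_of_section hf hfg s.hom
      (congrArg ModuleCat.Hom.hom hs)) hX)
  | succ m ih =>
    intro A hA h
    obtain ⟨X, B, f, g, hX, hf, hfg, hg, hB⟩ := hasCoresolutionOfLength_succ_iff.1 h
    exact hasCoresolutionOfLength_succ_iff.2 ⟨X, B, f, g, hX, hf, hfg, hg, ih B
      (fun Y hY ↦ subsingleton_ext_right_term (shortExact_of_exact f g hf hfg hg) Y (m + 1)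
        (hext Y X hY hX m) (hA Y hY)) hB⟩

end Coresolution

theorem IsTilting.subsingleton_ext {n : ℕ} {T : ModuleCat.{u} Rᵐᵒᵖ} (hT : IsTilting n T)
    {X Y : ModuleCat.{u} Rᵐᵒᵖ} (hX : IsSummandOfCopies T X) (hY : IsSummandOfCopies T Y) (i : ℕ) :
    Subsingleton (Abelian.Ext X Y (i + 1)) := by
  obtain ⟨A, hA⟩ := hX
  obtain ⟨B, hB⟩ := hY
  obtain ⟨rX⟩ := IsDirectSummand.nonempty_retract (Y := ModuleCat.of Rᵐᵒᵖ (A →₀ T)) hA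
  obtain ⟨rY⟩ := IsDirectSummand.nonempty_retract (Y := ModuleCat.of Rᵐᵒᵖ (B →₀ T)) hB
  exact subsingleton_ext_of_retract rX rY _
    (subsingleton_ext_finsupp T A _ _ (hT.ext_copies _ i.succ_pos B))

theorem IsTilting.subsingleton_ext_of_lt {n : ℕ} {T : ModuleCat.{u} Rᵐᵒᵖ} (hT : IsTilting n T)
    {X : ModuleCat.{u} Rᵐᵒᵖ} (hX : IsSummandOfCopies T X) (Y : ModuleCat.{u} Rᵐᵒᵖ) {i : ℕ}
    (hi : n < i) : Subsingleton (Abelian.Ext X Y i) := by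
  obtain ⟨A, hA⟩ := hX
  obtain ⟨r⟩ := IsDirectSummand.nonempty_retract (Y := ModuleCat.of Rᵐᵒᵖ (A →₀ T)) hA
  have := hT.projectiveResolution.hasProjectiveDimensionLE
  exact subsingleton_ext_of_retract r (.refl Y) _ (subsingleton_ext_finsupp T A _ _
    (HasProjectiveDimensionLT.subsingleton T (n + 1) i hi Y))

/-- The coresolution of `R` by summands of copies of an `n`-tilting module can be taken of
length `n`. -/
theorem IsTilting.hasCoresolutionOfLength {n : ℕ} {T : ModuleCat.{u} Rᵐᵒᵖ}
    (hT : IsTilting n T) :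
    HasCoresolutionOfLength (IsSummandOfCopies T) n (ModuleCat.of Rᵐᵒᵖ R) := by
  obtain ⟨m, hm⟩ := hT.coresolution
  rcases le_total m n with hmn | hnm
  · exact hm.of_le (fun X _ ↦ ⟨PEmpty, isDirectSummand_of_subsingleton⟩) hmn
  · induction m, hnm using Nat.le_induction with
    | base => exact hm
    | succ m hnm ih =>
      exact ih (hm.shorten (fun _ _ ↦ .of_isDirectSummand)
        (fun _ _ hX hY ↦ hT.subsingleton_ext hX hY) m _
        fun X hX ↦ hT.subsingleton_ext_of_lt hX _ (by lia))

/-- A single copower `T^(A)` of `T`, with `A` nonempty, has a coresolution of `R` of length `n` by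
direct summands of `T^(A)` itself: `A` is assembled from the index sets needed for the terms of a
coresolution by summands of copies of `T`. -/
theorem IsTilting.exists_coresolution_finsupp {n : ℕ} {T : ModuleCat.{u} Rᵐᵒᵖ}
    (hT : IsTilting n T) : ∃ A : Type u, Nonempty A ∧
      HasCoresolutionOfLength (IsSummandOfFiniteCopies (ModuleCat.of Rᵐᵒᵖ (A →₀ T))) n
        (ModuleCat.of Rᵐᵒᵖ R) := by
  obtain ⟨X, d, η, hX, hz, hη, h₀, hd⟩ := hT.hasCoresolutionOfLength
  have hX' (i : ℕ) : IsSummandOfCopies T (X i) := by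
    rcases le_or_gt i n with hi | hi
    · exact hX i hi
    · have := hz i hi
      exact ⟨PEmpty, isDirectSummand_of_subsingleton⟩
  choose B hB using hX'
  refine ⟨Option (Σ i, B i), inferInstance, X, d, η, fun i _ ↦ ⟨1, ?_⟩, hz, hη, h₀, hd⟩
  refine (hB i).trans (.trans (isDirectSummand_finsupp_of_injective
    (fun b : B i ↦ some (⟨i, b⟩ : Σ i, B i)) fun b b' h ↦ ?_) (isDirectSummand_finsupp_self 0))
  simpa using h

/-! ### Invariance under passing to a copower -/

theorem KE_finsupp (T : ModuleCat.{u} Rᵐᵒᵖ) (A : Type u) [Nonempty A] (i : ℕ) :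
    KE i (ModuleCat.of Rᵐᵒᵖ (A →₀ T)) = KE i T := by
  ext M
  refine forall₂_congr fun j _ ↦ ⟨fun h ↦ ?_, subsingleton_ext_finsupp T A j M⟩
  obtain ⟨r⟩ := IsDirectSummand.nonempty_retract (Y := ModuleCat.of Rᵐᵒᵖ (A →₀ T))
    (isDirectSummand_finsupp_self (S := Rᵐᵒᵖ) (X := T) (Classical.arbitrary A))
  exact subsingleton_ext_of_retract r (.refl M) j h

/-- Membership in `Gen n` may be checked on any sequence of modules isomorphic to direct sums of
copies of `T`. -/
theorem mem_Gen_of_linearEquiv {n : ℕ} {T M : ModuleCat.{u} Rᵐᵒᵖ} {X : ℕ → Type u}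
    [∀ i, AddCommGroup (X i)] [∀ i, Module Rᵐᵒᵖ (X i)] (α : ℕ → Type u)
    (e : ∀ i, X i ≃ₗ[Rᵐᵒᵖ] (α i →₀ T)) (d : ∀ i, X (i + 1) →ₗ[Rᵐᵒᵖ] X i) (ε : X 0 →ₗ[Rᵐᵒᵖ] M)
    (hε : 1 ≤ n → Function.Surjective ε) (h₀ : 2 ≤ n → Function.Exact (d 0) ε)
    (hd : ∀ i, i + 3 ≤ n → Function.Exact (d (i + 1)) (d i)) : M ∈ Gen n T := by
  refine ⟨α, fun i ↦ (e i).toLinearMap ∘ₗ d i ∘ₗ (e (i + 1)).symm.toLinearMap,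
    ε ∘ₗ (e 0).symm.toLinearMap, fun h ↦ ?_, fun h x ↦ ?_, fun i h x ↦ ?_⟩
  · simpa using hε h
  · simpa [(e 1).symm.surjective.exists, LinearEquiv.eq_symm_apply] using h₀ h ((e 0).symm x)
  · simpa [LinearEquiv.eq_symm_apply, (e (i + 2)).symm.surjective.exists] using
      hd i h ((e (i + 1)).symm x)

theorem Gen_finsupp_subset (n : ℕ) (T : ModuleCat.{u} Rᵐᵒᵖ) (A : Type u) :
    Gen n (ModuleCat.of Rᵐᵒᵖ (A →₀ T)) ⊆ Gen n T := by
  rintro M ⟨α, d, ε, hε, h₀, hd⟩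
  -- `(T^(A))^(α i)` is `T^(α i × A)`.
  exact mem_Gen_of_linearEquiv (fun i ↦ α i × A)
    (fun i ↦ (Finsupp.curryLinearEquiv Rᵐᵒᵖ).symm) d ε hε h₀ hd

theorem exact_prodMap {S : Type*} [Ring S] {X Y Z X' Y' Z' : Type*}
    [AddCommGroup X] [AddCommGroup Y] [AddCommGroup Z] [Module S X] [Module S Y] [Module S Z]
    [AddCommGroup X'] [AddCommGroup Y'] [AddCommGroup Z'] [Module S X'] [Module S Y'] [Module S Z']
    {f : X →ₗ[S] Y} {g : Y →ₗ[S] Z} {f' : X' →ₗ[S] Y'} {g' : Y' →ₗ[S] Z'}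
    (h : Function.Exact f g) (h' : Function.Exact f' g') :
    Function.Exact (f.prodMap f') (g.prodMap g') := by
  rintro ⟨y, y'⟩
  simp [Prod.ext_iff, h y, h' y']

/-- A family of index sets becomes a family of multiples of a nonempty `A` after adding one and the
same sufficiently large infinite set to all its members. -/
theorem exists_sum_equiv_prod (α : ℕ → Type u) (A : Type u) [Nonempty A] :
    ∃ δ : Type u, ∀ i, Nonempty (α i ⊕ δ ≃ δ × A) := by
  let δ : Type u := (ℕ ⊕ Σ i, α i) ⊕ A
  have hinf : Cardinal.aleph0 ≤ Cardinal.mk δ := Cardinal.aleph0_le_mk δ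
  refine ⟨δ, fun i ↦ ?_⟩
  have hα : Cardinal.mk (α i) ≤ Cardinal.mk δ := Cardinal.mk_le_of_injective
    (f := fun x ↦ (Sum.inl (Sum.inr ⟨i, x⟩) : δ)) fun x y h ↦ by simpa [δ] using h
  have hA : Cardinal.mk A ≤ Cardinal.mk δ := Cardinal.mk_le_of_injective
    (f := fun x ↦ (Sum.inr x : δ)) Sum.inr_injective
  rw [← Cardinal.eq, Cardinal.mk_sum, Cardinal.mk_prod, Cardinal.lift_id, Cardinal.lift_id,
    Cardinal.lift_id, Cardinal.add_eq_right hinf hα,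
    Cardinal.mul_eq_left hinf hA (Cardinal.mk_ne_zero A)]

/-- A sequence witnessing `M ∈ Gen n T` is extended by the exact complex
`⋯ → W →(0) W →(id) W → 0` with `W = T^(δ)`, where `δ` is so large that all terms of the sum
become direct sums of copies of `T^(A)`. -/
theorem Gen_subset_Gen_finsupp (n : ℕ) (T : ModuleCat.{u} Rᵐᵒᵖ) (A : Type u) [Nonempty A] :
    Gen n T ⊆ Gen n (ModuleCat.of Rᵐᵒᵖ (A →₀ T)) := by
  rintro M ⟨α, d, ε, hε, h₀, hd⟩
  obtain ⟨δ, hδ⟩ := exists_sum_equiv_prod α A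
  let c : ℕ → ((δ →₀ T) →ₗ[Rᵐᵒᵖ] (δ →₀ T)) := fun i ↦ if Even i then LinearMap.id else 0
  have hc (i : ℕ) : Function.Exact (c (i + 1)) (c i) := by
    intro x
    by_cases hi : Even i <;> simp [c, hi, Nat.even_add_one, eq_comm]
  refine mem_Gen_of_linearEquiv (X := fun i ↦ (α i →₀ T) × (δ →₀ T)) (fun _ ↦ δ)
    (fun i ↦ (Finsupp.sumFinsuppLEquivProdFinsupp Rᵐᵒᵖ).symm ≪≫ₗ
      Finsupp.domLCongr (hδ i).some ≪≫ₗ Finsupp.curryLinearEquiv Rᵐᵒᵖ)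
    (fun i ↦ (d i).prodMap (c i)) (ε ∘ₗ LinearMap.fst _ _ _) (fun h ↦ ?_) (fun h ↦ ?_)
    (fun i h ↦ exact_prodMap (hd i h) (hc i))
  · exact (hε h).comp Prod.fst_surjective
  · rintro ⟨x, y⟩
    simp [c, h₀ h x]

theorem tiltingEquivalent_finsupp (n : ℕ) (T : ModuleCat.{u} Rᵐᵒᵖ) (A : Type u) [Nonempty A] :
    TiltingEquivalent n T (ModuleCat.of Rᵐᵒᵖ (A →₀ T)) :=
  (Gen_subset_Gen_finsupp n T A).antisymm (Gen_finsupp_subset n T A)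

theorem IsTilting.isGoodTilting_finsupp {n : ℕ} {T : ModuleCat.{u} Rᵐᵒᵖ} (hT : IsTilting n T)
    {A : Type u} (h : HasCoresolutionOfLength
      (IsSummandOfFiniteCopies (ModuleCat.of Rᵐᵒᵖ (A →₀ T))) n (ModuleCat.of Rᵐᵒᵖ R)) :
    IsGoodTilting n (ModuleCat.of Rᵐᵒᵖ (A →₀ T)) where
  projectiveResolution := hT.projectiveResolution.finsupp A
  ext_copies i hi B := by
    obtain ⟨i, rfl⟩ := Nat.exists_eq_succ_of_ne_zero hi.ne'
    exact hT.subsingleton_ext ⟨A, isDirectSummand_of_linearEquiv (.refl _ _)⟩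
      ⟨B × A, isDirectSummand_of_linearEquiv (Finsupp.curryLinearEquiv Rᵐᵒᵖ).symm⟩ i
  coresolution := by
    obtain ⟨X, d, η, hX, h⟩ := h
    exact ⟨n, X, d, η, fun i hi ↦ (hX i hi).isSummandOfCopies, h⟩
  finiteCoresolution := h

end RightTilting

theorem mainTheorem5 {R : Type u} [Ring R] (n : ℕ) (T : ModuleCat.{u} Rᵐᵒᵖ)
    (hT : RightTilting.IsTilting n T) :
    ∃ T' : ModuleCat.{u} Rᵐᵒᵖ,
      RightTilting.IsGoodTilting n T' ∧
      RightTilting.TiltingEquivalent n T T' ∧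
      ∀ i : ℕ, RightTilting.KE i T = RightTilting.KE i T' := by
  obtain ⟨A, _, hA⟩ := hT.exists_coresolution_finsupp
  exact ⟨_, hT.isGoodTilting_finsupp hA, RightTilting.tiltingEquivalent_finsupp n T A,
    fun i ↦ (RightTilting.KE_finsupp T A i).symm⟩
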